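/- Let $p\ge 1$ be an integer, let $Z$ be a standard normal random variable, and let $\Phi h=\mathbb{E}h(Z)$. Write $\|g\|=\sup_{x\in\mathbb{R}}|g(x)|$, and let $C_b^{m}(\mathbb{R})$ be the set of bounded, $m$ times differentiable functions $h:\mathbb{R}\to\mathbb{R}$ whose derivatives $h^{(k)}$, $k\le m$, are all bounded. For $h\in C_b^{p+1}(\mathbb{R})$ put \[N_p=\min\bigg\{3\|h^{(p-1)}\|,\ \frac{\Gamma(\frac{p+1}{2})\,\|h^{(p)}\|}{\sqrt{2}\,\Gamma(\frac p2+1)},\ \frac{\|h^{(p+1)}\|}{p+1}\bigg\}.\] Let $n\ge 1$ and let $X_1,\ldots,X_n$ be independent real random variables with $\mathbb{E}|X_i|^{p+1}<\infty$ and $\mathbb{E}X_i^k=\mathbb{E}Z^k$ for all $1\le i\le n$ and $1\le k\le p$, and let $W_n=\frac{1}{\sqrt n}\sum_{i=1}^nX_i$. Then, for all $h\in C_b^{p+1}(\mathbb{R})$, \[|\mathbb{E}h(W_n)-\Phi h|\le \frac{N_p}{n^{(p+1)/2}}\sum_{i=1}^n\bigg(\frac{\mathbb{E}|X_i|^{p-1}}{(p-1)!}+\frac{\mathbb{E}|X_i|^{p+1}}{p!}\bigg).\]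 If in addition $X_1,\ldots,X_n$ are identically distributed with common law $\mu$, then the right-hand side is of order $n^{-(p-1)/2}$: there are constants $c$ and $C$, depending only on $p$, $h$ and $\mu$, such that for all $n\ge1$ the right-hand side lies between $c\,n^{-(p-1)/2}$ and $C\,n^{-(p-1)/2}$, and consequently $|\mathbb{E}h(W_n)-\Phi h|\le C\,n^{-(p-1)/2}$; moreover $c>0$ whenever $h$ is not constant. -/

import Mathlib

open MeasureTheory ProbabilityTheory
open scoped Nat

universe u

noncomputable section

namespace MatchingMoments

/-- The supremum norm `sup_x |f x|` (used only for bounded functions). -/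
def supNorm (f : ℝ → ℝ) : ℝ := ⨆ x : ℝ, |f x|

/-- The class `C_b^n(ℝ)`: functions that are `n` times differentiable and bounded, with bounded
derivatives of every order up to `n`. Continuity of the `n`-th derivative is not required. -/
def MemCb (n : ℕ) (h : ℝ → ℝ) : Prop :=
  (∀ k < n, Differentiable ℝ (iteratedDeriv k h)) ∧
    ∀ k ≤ n, ∃ C : ℝ, ∀ x : ℝ, |iteratedDeriv k h x| ≤ C

/-- The constant `N_k` attached to a test function `h`, for `k ≥ 1`. -/
def N (h : ℝ → ℝ) (k : ℕ) : ℝ :=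
  min (3 * supNorm (iteratedDeriv (k - 1) h))
    (min
      (Real.Gamma (((k : ℝ) + 1) / 2) * supNorm (iteratedDeriv k h) /
        (Real.sqrt 2 * Real.Gamma ((k : ℝ) / 2 + 1)))
      (supNorm (iteratedDeriv (k + 1) h) / ((k : ℝ) + 1)))

/-- `Φ h = E h(Z)` for a standard normal `Z`. -/
def normalExp (h : ℝ → ℝ) : ℝ := ∫ x, h x ∂(gaussianReal 0 1)

/-- A law on `ℝ` with finite `(p+1)`-th absolute moment, whose moments of orders `1, …, p` are
those of the standard normal distribution. -/
def MatchesNormal (p : ℕ) (μ : Measure ℝ) : Prop :=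
  Integrable (fun x : ℝ => |x| ^ (p + 1)) μ ∧
    ∀ k : ℕ, 1 ≤ k → k ≤ p → ∫ x, x ^ k ∂μ = ∫ x, x ^ k ∂(gaussianReal 0 1)

variable {Ω : Type*}

/-- The standardised sum `W_n = n^{-1/2} ∑ X_i`. -/
def W {n : ℕ} (X : Fin n → Ω → ℝ) (ω : Ω) : ℝ := (∑ i, X i ω) / Real.sqrt n

/-- The approximation error `|E h(W_n) - Φ h|`. -/
def error [MeasurableSpace Ω] (P : Measure Ω) (h : ℝ → ℝ) {n : ℕ} (X : Fin n → Ω → ℝ) : ℝ :=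
  |(∫ ω, h (W X ω) ∂P) - normalExp h|

/-- The right-hand side
`N_p n^{-(p+1)/2} ∑_i (E|X_i|^{p-1} / (p-1)! + E|X_i|^{p+1} / p!)`, for `p ≥ 1`. -/
def bound [MeasurableSpace Ω] (P : Measure Ω) (h : ℝ → ℝ) (p : ℕ) {n : ℕ}
    (X : Fin n → Ω → ℝ) : ℝ :=
  N h p / (n : ℝ) ^ (((p : ℝ) + 1) / 2) *
    ∑ i, ((∫ ω, |X i ω| ^ (p - 1) ∂P) / ((p - 1)! : ℝ) +
      (∫ ω, |X i ω| ^ (p + 1) ∂P) / (p ! : ℝ))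

end MatchingMoments

end

namespace MatchingMoments

/-! ### Gaussian integrals -/

/-! The proof is Stein's method. The equation `f' - x f = h - Φ h` is solved by `f = -ouAverage 0
h'`, an average of `h'` over points `x cos θ + Z sin θ`. Differentiating under the integral gains
one factor `cos θ` each time, so `f^(p)` is minus an average of `h^(p+1)`, and it is bounded in
three ways, giving the three entries of `N`. Bounding the average directly gives the weight
`1/(p+1)` (`abs_ouAverage_le`). A Gaussian integration by parts removes one derivative, giving the
Gamma quotient (`abs_ouAverage_deriv_le`). Two derivatives are saved by differentiating the Stein
equation and applying a monotonicity argument (`abs_mul_add_le`).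

With `Y_i = X_i / √n` and `V_i = W_n - Y_i`, the error is the sum over `i` of `E[f'(W_n)/n - Y_i
f(W_n)]`. Taylor expansion about `V_i`, which is independent of `Y_i`, leaves polynomial terms whose
expectations cancel, because matching moments satisfy the Gaussian recursion `E Y^(l+2) = s (l+1) E
Y^l` with `s = 1/n`. Only remainders controlled by `f^(p)` survive (`abs_stein_summand_le`). For a
common law the bound is exactly a constant times `n^(-(p-1)/2)`. -/

lemma integrable_gaussianReal_iff {g : ℝ → ℝ} :
    Integrable g (gaussianReal 0 1) ↔ Integrable fun x => g x * gaussianPDFReal 0 1 x := by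
  rw [gaussianReal_of_var_ne_zero 0 one_ne_zero,
    integrable_withDensity_iff (measurable_gaussianPDF 0 1)
      (Filter.Eventually.of_forall fun _ => gaussianPDF_lt_top)]
  simp only [toReal_gaussianPDF]

lemma integral_gaussianReal_eq (g : ℝ → ℝ) :
    ∫ x, g x ∂(gaussianReal 0 1) = ∫ x, g x * gaussianPDFReal 0 1 x := by
  rw [integral_gaussianReal_eq_integral_smul one_ne_zero]
  simp only [smul_eq_mul, mul_comm]

lemma hasDerivAt_gaussianPDFReal (x : ℝ) :
    HasDerivAt (gaussianPDFReal 0 1) (-x * gaussianPDFReal 0 1 x) x := by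
  have h : HasDerivAt (fun y : ℝ => -(y - 0) ^ 2 / (2 * ((1 : NNReal) : ℝ))) (-x) x := by
    have := (((hasDerivAt_id x).sub_const 0).pow 2).neg.div_const (2 * ((1 : NNReal) : ℝ))
    convert! this using 1
    simp only [id_eq, NNReal.coe_one]
    norm_num
    ring
  have := (h.exp).const_mul (Real.sqrt (2 * Real.pi * ((1 : NNReal) : ℝ)))⁻¹
  rw [gaussianPDFReal_def]
  convert! this using 1
  ring

/-- Gaussian integration by parts. -/
lemma integral_id_mul_gaussianReal {g g' : ℝ → ℝ} (hg : ∀ x, HasDerivAt g (g' x) x)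
    (hi : Integrable g (gaussianReal 0 1)) (hi' : Integrable g' (gaussianReal 0 1))
    (hxi : Integrable (fun x => x * g x) (gaussianReal 0 1)) :
    ∫ x, x * g x ∂(gaussianReal 0 1) = ∫ x, g' x ∂(gaussianReal 0 1) := by
  rw [integrable_gaussianReal_iff] at hi hi' hxi
  rw [integral_gaussianReal_eq, integral_gaussianReal_eq]
  have key := integral_mul_deriv_eq_deriv_mul_of_integrable (u := g) (u' := g')
    (v := gaussianPDFReal 0 1) (v' := fun x => -x * gaussianPDFReal 0 1 x)
    (fun x _ => hg x) (fun x _ => hasDerivAt_gaussianPDFReal x)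
    (hxi.neg.congr (Filter.Eventually.of_forall fun x => by simp; ring)) hi' hi
  rw [← neg_inj, ← key, ← integral_neg]
  congr 1 with x
  ring

lemma integrable_pow_gaussianReal (k : ℕ) :
    Integrable (fun x : ℝ => x ^ k) (gaussianReal 0 1) := by
  have := (memLp_id_gaussianReal (μ := 0) (v := 1) k).integrable_norm_pow'
  refine this.mono' (by fun_prop) (Filter.Eventually.of_forall fun x => ?_)
  simp

/-- Integration by parts with `g = x^(k+1)`. This recursion is all that the Taylor cancellation uses
about normal moments of order at least two. -/
lemma integral_pow_add_two_gaussianReal (k : ℕ) :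
    ∫ x, x ^ (k + 2) ∂(gaussianReal 0 1) = (k + 1) * ∫ x, x ^ k ∂(gaussianReal 0 1) := by
  rw [← integral_const_mul]
  have := integral_id_mul_gaussianReal (g := fun x => x ^ (k + 1))
    (g' := fun x => (k + 1) * x ^ k) (fun x => by simpa using hasDerivAt_pow (k + 1) x)
    (integrable_pow_gaussianReal _) ((integrable_pow_gaussianReal k).const_mul _)
    ((integrable_pow_gaussianReal (k + 2)).congr
      (Filter.Eventually.of_forall fun x => by simp only; ring))
  rw [← this]
  congr 1 with x
  ring

lemma integral_abs_gaussianReal :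
    ∫ x, |x| ∂(gaussianReal 0 1) = Real.sqrt 2 / Real.sqrt Real.pi := by
  have h1 : ∫ x in Set.Ioi (0 : ℝ), x * Real.exp (-(1 / 2) * x ^ 2) = 1 := by
    have := integral_rpow_mul_exp_neg_mul_rpow (p := 2) (q := 1) (b := 1 / 2)
      (by norm_num) (by norm_num) (by norm_num)
    norm_num at this
    simpa using this
  have h2 := integral_comp_abs (f := fun x : ℝ => x * Real.exp (-(1 / 2) * x ^ 2))
  rw [h1] at h2
  have hpi := Real.sqrt_pos.2 Real.pi_pos
  have h22 : Real.sqrt 2 * Real.sqrt 2 = 2 := Real.mul_self_sqrt (by norm_num)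
  calc ∫ x, |x| ∂(gaussianReal 0 1)
      = ∫ x, (Real.sqrt (2 * Real.pi))⁻¹ * (|x| * Real.exp (-(1 / 2) * |x| ^ 2)) := by
        rw [integral_gaussianReal_eq]
        congr 1 with x
        simp only [gaussianPDFReal, NNReal.coe_one, mul_one, sub_zero, sq_abs]
        rw [show -x ^ 2 / 2 = -(1 / 2) * x ^ 2 by ring]
        ring
    _ = Real.sqrt 2 / Real.sqrt Real.pi := by
        rw [integral_const_mul, h2, Real.sqrt_mul (by norm_num)]
        field_simp
        nlinarith

lemma integrable_abs_gaussianReal : Integrable (fun x : ℝ => |x|) (gaussianReal 0 1) := by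
  simpa using (integrable_pow_gaussianReal 1).abs

/-! ### The integral of a power of cosine -/

/-- The reduction formula for cosine powers and the Gamma recursion both step by two. The value is
the source of the Gamma quotient in `N`. -/
lemma integral_cos_pow_eq_gamma (p : ℕ) :
    ∫ θ in (0 : ℝ)..(Real.pi / 2), Real.cos θ ^ p =
      Real.sqrt Real.pi / 2 * Real.Gamma (((p : ℝ) + 1) / 2) / Real.Gamma ((p : ℝ) / 2 + 1) := by
  have hpi : Real.sqrt Real.pi * Real.sqrt Real.pi = Real.pi := Real.mul_self_sqrt Real.pi_pos.le
  have hpi0 := Real.sqrt_pos.2 Real.pi_pos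
  induction p using Nat.twoStepInduction with
  | zero =>
    simp only [pow_zero, integral_one, Nat.cast_zero, zero_add, zero_div, Real.Gamma_one,
      Real.Gamma_one_half_eq, sub_zero, div_one]
    linarith
  | one =>
    have : Real.Gamma ((1 : ℝ) / 2 + 1) = 1 / 2 * Real.sqrt Real.pi := by
      rw [Real.Gamma_add_one (by norm_num), Real.Gamma_one_half_eq]
    simp only [pow_one, integral_cos, Nat.cast_one, this, Real.sin_pi_div_two, Real.sin_zero]
    norm_num
    field_simp
  | more p ih _ =>
    rw [integral_cos_pow, ih]
    push_cast
    have h1 : ((p : ℝ) + 2 + 1) / 2 = ((p : ℝ) + 1) / 2 + 1 := by ring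
    have h2 : ((p : ℝ) + 2) / 2 + 1 = ((p : ℝ) / 2 + 1) + 1 := by ring
    have hp : (0 : ℝ) ≤ p := p.cast_nonneg
    have h3 := Real.Gamma_pos_of_pos (show 0 < (p : ℝ) / 2 + 1 by positivity)
    rw [h1, h2, Real.Gamma_add_one (s := ((p : ℝ) + 1) / 2) (by positivity),
      Real.Gamma_add_one (s := (p : ℝ) / 2 + 1) (by positivity)]
    generalize Real.Gamma ((p : ℝ) / 2 + 1) = a at *
    generalize Real.Gamma (((p : ℝ) + 1) / 2) = b at *
    simp only [Real.cos_pi_div_two, Real.sin_zero]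
    have hp2 : (p : ℝ) / 2 + 1 ≠ 0 := by positivity
    field_simp
    ring

end MatchingMoments

namespace MatchingMoments

/-! ### Ornstein–Uhlenbeck averages -/

noncomputable section

/-- The product of Lebesgue measure on `(0, π / 2]` and the standard normal law. -/
def arcMeasure : Measure (ℝ × ℝ) :=
  (volume.restrict (Set.Ioc 0 (Real.pi / 2))).prod (gaussianReal 0 1)

instance : IsFiniteMeasure arcMeasure := by
  unfold arcMeasure; infer_instance

/-- The point `x cos θ + z sin θ`, for `q = (θ, z)`. -/
def rot (x : ℝ) (q : ℝ × ℝ) : ℝ := x * Real.cos q.1 + q.2 * Real.sin q.1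

/-- The average `∫₀^{π/2} cos^j θ sin θ E g(x cos θ + Z sin θ) dθ`, which is the resolvent at
`j + 1` of the Ornstein–Uhlenbeck semigroup applied to `g`. -/
def ouAverage (j : ℕ) (g : ℝ → ℝ) (x : ℝ) : ℝ :=
  ∫ q, Real.cos q.1 ^ j * Real.sin q.1 * g (rot x q) ∂arcMeasure

end

lemma continuous_rot (x : ℝ) : Continuous (rot x) := by
  unfold rot; fun_prop

lemma hasDerivAt_rot (x : ℝ) (q : ℝ × ℝ) :
    HasDerivAt (fun y => rot y q) (Real.cos q.1) x := by
  simpa [rot] using ((hasDerivAt_id x).mul_const (Real.cos q.1)).add_const (q.2 * Real.sin q.1)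

lemma ae_arcMeasure_fst_mem : ∀ᵐ q ∂arcMeasure, q.1 ∈ Set.Ioc 0 (Real.pi / 2) :=
  Measure.quasiMeasurePreserving_fst.ae (ae_restrict_mem measurableSet_Ioc)

lemma ae_arcMeasure_trig_nonneg :
    ∀ᵐ q ∂arcMeasure, 0 ≤ Real.cos q.1 ∧ 0 ≤ Real.sin q.1 := by
  filter_upwards [ae_arcMeasure_fst_mem] with q hq
  have := Real.pi_pos
  exact ⟨Real.cos_nonneg_of_mem_Icc ⟨by linarith [hq.1], hq.2⟩,
    Real.sin_nonneg_of_nonneg_of_le_pi hq.1.le (by linarith [hq.2])⟩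

lemma abs_cos_pow_mul_sin_le_one (j : ℕ) (θ : ℝ) : |Real.cos θ ^ j * Real.sin θ| ≤ 1 := by
  rw [abs_mul, abs_pow]
  exact mul_le_one₀ (pow_le_one₀ (abs_nonneg _) (Real.abs_cos_le_one θ)) (abs_nonneg _)
    (Real.abs_sin_le_one θ)

lemma integrable_arcMeasure_abs_snd : Integrable (fun q : ℝ × ℝ => |q.2|) arcMeasure :=
  integrable_abs_gaussianReal.comp_snd _

lemma integrable_ouAverage {g : ℝ → ℝ} {M : ℝ} (hg : Measurable g) (hM : ∀ x, |g x| ≤ M)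
    (j : ℕ) (x : ℝ) :
    Integrable (fun q => Real.cos q.1 ^ j * Real.sin q.1 * g (rot x q)) arcMeasure := by
  have hr := (continuous_rot x).measurable
  refine (integrable_const M).mono' (by fun_prop) (Filter.Eventually.of_forall fun q => ?_)
  rw [Real.norm_eq_abs, abs_mul]
  exact (mul_le_of_le_one_left (abs_nonneg _) (abs_cos_pow_mul_sin_le_one j q.1)).trans (hM _)

lemma integral_cos_pow_mul_sin (j : ℕ) :
    ∫ θ in (0 : ℝ)..(Real.pi / 2), Real.cos θ ^ j * Real.sin θ = 1 / ((j : ℝ) + 1) := by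
  have hj : (j : ℝ) + 1 ≠ 0 := by positivity
  have hd : ∀ θ : ℝ, HasDerivAt (fun θ => -(Real.cos θ ^ (j + 1) / ((j : ℝ) + 1)))
      (Real.cos θ ^ j * Real.sin θ) θ := fun θ => by
    have := (((Real.hasDerivAt_cos θ).pow (j + 1)).div_const ((j : ℝ) + 1)).neg
    convert! this using 1
    push_cast
    field_simp
  rw [intervalIntegral.integral_eq_sub_of_hasDerivAt (fun θ _ => hd θ)
    (Continuous.intervalIntegrable (by fun_prop) _ _)]
  simp

lemma abs_ouAverage_le {g : ℝ → ℝ} {M : ℝ} (hM : ∀ x, |g x| ≤ M) (j : ℕ) (x : ℝ) :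
    |ouAverage j g x| ≤ M / ((j : ℝ) + 1) := by
  have hint : Integrable (fun q : ℝ × ℝ => Real.cos q.1 ^ j * Real.sin q.1 * M) arcMeasure :=
    integrable_ouAverage (g := fun _ => M) measurable_const (M := |M|) (fun _ => le_rfl) j 0
  calc |ouAverage j g x|
      = ‖∫ q, Real.cos q.1 ^ j * Real.sin q.1 * g (rot x q) ∂arcMeasure‖ := rfl
    _ ≤ ∫ q, Real.cos q.1 ^ j * Real.sin q.1 * M ∂arcMeasure := by
        refine norm_integral_le_of_norm_le (μ := arcMeasure) hint ?_
        filter_upwards [ae_arcMeasure_trig_nonneg] with q hq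
        rw [Real.norm_eq_abs, abs_mul,
          abs_of_nonneg (mul_nonneg (pow_nonneg hq.1 j) hq.2)]
        exact mul_le_mul_of_nonneg_left (hM _) (mul_nonneg (pow_nonneg hq.1 j) hq.2)
    _ = M / ((j : ℝ) + 1) := by
        rw [arcMeasure, integral_fun_fst (fun θ => Real.cos θ ^ j * Real.sin θ * M),
          integral_mul_const, ← intervalIntegral.integral_of_le (by positivity),
          integral_cos_pow_mul_sin]
        simp
        ring

lemma measurable_of_hasDerivAt {g g' : ℝ → ℝ} (hg : ∀ x, HasDerivAt g (g' x) x) :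
    Measurable g' := by
  rw [show g' = deriv g from funext fun x => (hg x).deriv.symm]
  exact measurable_deriv g

lemma continuous_of_hasDerivAt {g g' : ℝ → ℝ} (hg : ∀ x, HasDerivAt g (g' x) x) :
    Continuous g :=
  continuous_iff_continuousAt.2 fun x => (hg x).continuousAt

/-- The chain rule contributes `cos θ`, the derivative of `rot` in `x`, which raises the index.
Boundedness of `g'` gives the dominating function, so `g'` need not be continuous. -/
lemma hasDerivAt_ouAverage {g g' : ℝ → ℝ} {M M' : ℝ} (hg : ∀ x, HasDerivAt g (g' x) x)
    (hM : ∀ x, |g x| ≤ M) (hM' : ∀ x, |g' x| ≤ M') (j : ℕ) (x : ℝ) :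
    HasDerivAt (ouAverage j g) (ouAverage (j + 1) g' x) x := by
  have hgm := (continuous_of_hasDerivAt hg).measurable
  have hgm' := measurable_of_hasDerivAt hg
  refine (hasDerivAt_integral_of_dominated_loc_of_deriv_le (μ := arcMeasure)
    (F := fun x q => Real.cos q.1 ^ j * Real.sin q.1 * g (rot x q))
    (F' := fun x q => Real.cos q.1 ^ (j + 1) * Real.sin q.1 * g' (rot x q))
    (bound := fun _ => M') Filter.univ_mem
    (Filter.Eventually.of_forall fun y => (integrable_ouAverage hgm hM j y).aestronglyMeasurable)
    (integrable_ouAverage hgm hM j x)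
    (integrable_ouAverage hgm' hM' (j + 1) x).aestronglyMeasurable
    (Filter.Eventually.of_forall fun q y _ => ?_) (integrable_const _)
    (Filter.Eventually.of_forall fun q y _ => ?_)).2
  · rw [Real.norm_eq_abs, abs_mul]
    exact (mul_le_of_le_one_left (abs_nonneg _)
      (abs_cos_pow_mul_sin_le_one (j + 1) q.1)).trans (hM' _)
  · have := (((hg (rot y q)).comp y (hasDerivAt_rot y q)).const_mul
      (Real.cos q.1 ^ j * Real.sin q.1))
    convert! this using 1
    ring

lemma integrable_cos_pow_mul_snd_mul {g : ℝ → ℝ} {M : ℝ} (hg : Measurable g)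
    (hM : ∀ x, |g x| ≤ M) (j : ℕ) (x : ℝ) :
    Integrable (fun q => Real.cos q.1 ^ j * (q.2 * g (rot x q))) arcMeasure := by
  have hr := (continuous_rot x).measurable
  refine (integrable_arcMeasure_abs_snd.mul_const M).mono' (by fun_prop)
    (Filter.Eventually.of_forall fun q => ?_)
  rw [Real.norm_eq_abs, abs_mul, abs_mul, abs_pow]
  exact (mul_le_of_le_one_left (by positivity)
    (pow_le_one₀ (abs_nonneg _) (Real.abs_cos_le_one _))).trans
      (mul_le_mul_of_nonneg_left (hM _) (abs_nonneg _))

/-- Gaussian integration by parts inside an Ornstein–Uhlenbeck average. -/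
lemma integral_cos_pow_mul_snd_mul {g g' : ℝ → ℝ} {M M' : ℝ}
    (hg : ∀ x, HasDerivAt g (g' x) x) (hM : ∀ x, |g x| ≤ M) (hM' : ∀ x, |g' x| ≤ M')
    (j : ℕ) (x : ℝ) :
    ∫ q, Real.cos q.1 ^ j * (q.2 * g (rot x q)) ∂arcMeasure = ouAverage j g' x := by
  have hgm := (continuous_of_hasDerivAt hg).measurable
  have hgm' := measurable_of_hasDerivAt hg
  have i1 := integrable_cos_pow_mul_snd_mul hgm hM j x
  have i2 := integrable_ouAverage hgm' hM' j x
  unfold ouAverage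
  unfold arcMeasure at i1 i2 ⊢
  rw [integral_prod _ i1, integral_prod _ i2]
  congr 1 with θ
  have hd : ∀ z, HasDerivAt (fun z => g (rot x (θ, z))) (Real.sin θ * g' (rot x (θ, z))) z := by
    intro z
    have h1 : HasDerivAt (fun z => rot x (θ, z)) (Real.sin θ) z := by
      simpa [rot] using ((hasDerivAt_id z).mul_const (Real.sin θ)).const_add (x * Real.cos θ)
    rw [mul_comm]
    exact (hg _).comp z h1
  have hr : Measurable fun z : ℝ => rot x (θ, z) := by unfold rot; fun_prop
  have key := integral_id_mul_gaussianReal hd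
    ((integrable_const M).mono' (hgm.comp hr).aestronglyMeasurable
      (Filter.Eventually.of_forall fun z => hM _))
    ((integrable_const M').mono' ((hgm'.comp hr).const_mul _).aestronglyMeasurable
      (Filter.Eventually.of_forall fun z => by
      rw [Real.norm_eq_abs, abs_mul]
      exact (mul_le_of_le_one_left (abs_nonneg _) (Real.abs_sin_le_one θ)).trans (hM' _)))
    ((integrable_abs_gaussianReal.mul_const M).mono'
      (measurable_id.mul (hgm.comp hr)).aestronglyMeasurable
      (Filter.Eventually.of_forall fun z => by
        rw [Real.norm_eq_abs, abs_mul]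
        exact mul_le_mul_of_nonneg_left (hM _) (abs_nonneg _)))
  simp only [mul_assoc]
  rw [integral_const_mul, key, ← integral_const_mul]

/-- Integration by parts trades `sin θ g'` for `Z g`, so only the bound on `g` enters. The constant
is `E|Z|` times the integral of `cos^j`. -/
lemma abs_ouAverage_deriv_le {g g' : ℝ → ℝ} {M M' : ℝ}
    (hg : ∀ x, HasDerivAt g (g' x) x) (hM : ∀ x, |g x| ≤ M) (hM' : ∀ x, |g' x| ≤ M')
    (j : ℕ) (x : ℝ) :
    |ouAverage j g' x| ≤ Real.Gamma (((j : ℝ) + 1) / 2) * M /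
      (Real.sqrt 2 * Real.Gamma ((j : ℝ) / 2 + 1)) := by
  rw [← integral_cos_pow_mul_snd_mul hg hM hM']
  have hint := integrable_cos_pow_mul_snd_mul (g := fun _ => M) measurable_const (M := |M|)
    (fun _ => le_rfl) j 0
  have hint' : Integrable (fun q : ℝ × ℝ => Real.cos q.1 ^ j * (|q.2| * M)) arcMeasure := by
    refine hint.norm.mono (by fun_prop) (Filter.Eventually.of_forall fun q => ?_)
    simp
  rw [← Real.norm_eq_abs]
  calc ‖∫ q, Real.cos q.1 ^ j * (q.2 * g (rot x q)) ∂arcMeasure‖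
      ≤ ∫ q, Real.cos q.1 ^ j * (|q.2| * M) ∂arcMeasure := by
        refine norm_integral_le_of_norm_le (μ := arcMeasure) hint' ?_
        filter_upwards [ae_arcMeasure_trig_nonneg] with q hq
        rw [Real.norm_eq_abs, abs_mul, abs_mul, abs_of_nonneg (pow_nonneg hq.1 j)]
        exact mul_le_mul_of_nonneg_left (mul_le_mul_of_nonneg_left (hM _) (abs_nonneg _))
          (pow_nonneg hq.1 j)
    _ = _ := by
        rw [arcMeasure, integral_prod_mul (fun θ => Real.cos θ ^ j) (fun z => |z| * M),
          ← intervalIntegral.integral_of_le (by positivity), integral_cos_pow_eq_gamma,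
          integral_mul_const, integral_abs_gaussianReal]
        have hpi := Real.sqrt_pos.2 Real.pi_pos
        have h22 : Real.sqrt 2 * Real.sqrt 2 = 2 := Real.mul_self_sqrt (by norm_num)
        have hG := Real.Gamma_pos_of_pos (show 0 < (j : ℝ) / 2 + 1 by positivity)
        generalize Real.Gamma ((j : ℝ) / 2 + 1) = a at *
        generalize Real.Gamma (((j : ℝ) + 1) / 2) = b at *
        field_simp
        linear_combination b * M * h22

/-- The Stein equation for the Ornstein–Uhlenbeck averages. -/
lemma ouAverage_stein {g g' g'' : ℝ → ℝ} {M M' M'' : ℝ} (hg : ∀ x, HasDerivAt g (g' x) x)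
    (hg' : ∀ x, HasDerivAt g' (g'' x) x) (hM : ∀ x, |g x| ≤ M) (hM' : ∀ x, |g' x| ≤ M')
    (hM'' : ∀ x, |g'' x| ≤ M'') (x : ℝ) :
    ouAverage 1 g'' x - x * ouAverage 0 g' x = normalExp g - g x := by
  have hgc := continuous_of_hasDerivAt hg
  have hgc' := continuous_of_hasDerivAt hg'
  have hint1 := integrable_ouAverage hgc'.measurable hM' 0 x
  have hint2 := integrable_cos_pow_mul_snd_mul hgc'.measurable hM' 1 x
  have hint := hint2.sub (hint1.const_mul x)
  -- The arc `θ ↦ x cos θ + z sin θ` runs from `x` to `z`, so this is the fundamental theorem of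
  -- calculus along it. Only continuity of `g'` is needed; `g''` enters through integration by parts
  -- in `z`.
  have hpath : ∀ z, ∫ θ in Set.Ioc 0 (Real.pi / 2), (Real.cos θ ^ 1 * (z * g' (rot x (θ, z))) -
      x * (Real.cos θ ^ 0 * Real.sin θ * g' (rot x (θ, z)))) = g z - g x := by
    intro z
    have hd : ∀ θ, HasDerivAt (fun θ => g (rot x (θ, z))) (Real.cos θ ^ 1 *
        (z * g' (rot x (θ, z))) - x * (Real.cos θ ^ 0 * Real.sin θ * g' (rot x (θ, z)))) θ := by
      intro θ
      have h1 : HasDerivAt (fun θ => rot x (θ, z)) (x * (-Real.sin θ) + z * Real.cos θ) θ :=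
        ((Real.hasDerivAt_cos θ).const_mul x).add ((Real.hasDerivAt_sin θ).const_mul z)
      convert! (hg _).comp θ h1 using 1
      ring
    have hr : Continuous fun θ : ℝ => rot x (θ, z) := by unfold rot; fun_prop
    rw [← intervalIntegral.integral_of_le (by positivity),
      intervalIntegral.integral_eq_sub_of_hasDerivAt (fun θ _ => hd θ)
        (Continuous.intervalIntegrable (by fun_prop) _ _)]
    simp [rot]
  have hgi : Integrable g (gaussianReal 0 1) :=
    (integrable_const M).mono' hgc.aestronglyMeasurable (Filter.Eventually.of_forall hM)
  calc ouAverage 1 g'' x - x * ouAverage 0 g' x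
      = ∫ q, (Real.cos q.1 ^ 1 * (q.2 * g' (rot x q)) -
          x * (Real.cos q.1 ^ 0 * Real.sin q.1 * g' (rot x q))) ∂arcMeasure := by
        rw [integral_sub hint2 (hint1.const_mul x), integral_const_mul,
          integral_cos_pow_mul_snd_mul hg' hM' hM'']
        rfl
    _ = ∫ z, (g z - g x) ∂(gaussianReal 0 1) := by
        unfold arcMeasure at hint ⊢
        refine (integral_prod_symm _ hint).trans ?_
        exact integral_congr_ae (Filter.Eventually.of_forall hpath)
    _ = normalExp g - g x := by
        rw [integral_sub hgi (integrable_const _)]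
        simp [normalExp]

end MatchingMoments

namespace MatchingMoments

/-! ### A comparison principle -/

/-- For `y = x v + q` one has `y' = (l+1) v + x y - x H`. After multiplication by a suitable
positive factor, `y` is decreasing on the positive half-line and vanishes at infinity, so it is
nonnegative. -/
lemma mul_add_nonneg_of_pos {l : ℕ} {H q v : ℝ → ℝ} {Q V : ℝ}
    (hq : ∀ x, HasDerivAt q (l * v x) x) (hv : ∀ x, HasDerivAt v (x * v x + q x - H x) x)
    (hH0 : ∀ x, 0 ≤ H x) (hq0 : ∀ x, 0 ≤ q x) (hQ : ∀ x, |q x| ≤ Q) (hV : ∀ x, |v x| ≤ V)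
    {x : ℝ} (hx : 0 < x) : 0 ≤ x * v x + q x := by
  -- The exponential absorbs `x y`, and the power absorbs `(l+1) v = (l+1)(y - q)/x`; only terms in
  -- `-H` and `-q` remain in the derivative.
  set D : ℝ → ℝ := fun t => Real.exp (-t ^ 2 / 2) * (t * v t + q t) / t ^ (l + 1) with hD
  have hderiv : ∀ t, 0 < t → HasDerivAt D
      (-(Real.exp (-t ^ 2 / 2) * t ^ l * (t ^ 2 * H t + (l + 1) * q t)) / (t ^ (l + 1)) ^ 2) t := by
    intro t ht
    have hE : HasDerivAt (fun t : ℝ => Real.exp (-t ^ 2 / 2))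
        (Real.exp (-t ^ 2 / 2) * (-t)) t := by
      have : HasDerivAt (fun t : ℝ => -t ^ 2 / 2) (-t) t := by
        convert! ((hasDerivAt_pow 2 t).neg.div_const 2) using 1
        simp
        ring
      exact this.exp
    have hy := ((hasDerivAt_id t).mul (hv t)).add (hq t)
    convert! (hE.mul hy).div (hasDerivAt_pow (l + 1) t) (pow_ne_zero _ ht.ne') using 1
    simp only [id_eq, Pi.mul_apply, Pi.add_apply, Nat.add_sub_cancel]
    push_cast
    congr 1
    ring
  have hanti : AntitoneOn D (Set.Ioi 0) := by
    refine antitoneOn_of_hasDerivWithinAt_nonpos (convex_Ioi 0)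
      (fun t ht => (hderiv t ht).continuousAt.continuousWithinAt)
      (fun t ht => (hderiv t (interior_subset ht)).hasDerivWithinAt) fun t ht => ?_
    have ht' : 0 < t := interior_subset ht
    rw [neg_div, neg_nonpos]
    have := hH0 t
    have := hq0 t
    positivity
  have hlim : Filter.Tendsto D Filter.atTop (nhds 0) := by
    have hE : Filter.Tendsto (fun t : ℝ => Real.exp (-t) * (V + Q)) Filter.atTop (nhds 0) := by
      simpa using Real.tendsto_exp_neg_atTop_nhds_zero.mul_const (V + Q)
    refine squeeze_zero_norm' ?_ hE
    filter_upwards [Filter.eventually_ge_atTop 2] with t ht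
    have ht0 : 0 < t := by linarith
    have h1 : |t * v t + q t| / t ^ (l + 1) ≤ V + Q := by
      rw [div_le_iff₀ (by positivity)]
      have hp : t ≤ t ^ (l + 1) := le_self_pow₀ (by linarith) (by omega)
      have hVn := (abs_nonneg _).trans (hV t)
      have hQn := (abs_nonneg _).trans (hQ t)
      calc |t * v t + q t| ≤ t * |v t| + |q t| := by
            refine (abs_add_le _ _).trans_eq ?_
            rw [abs_mul, abs_of_pos ht0]
        _ ≤ t * V + t * Q := by
            have := mul_le_mul_of_nonneg_left (hV t) ht0.le
            have := le_mul_of_one_le_left hQn (show 1 ≤ t by linarith)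
            linarith [hQ t]
        _ = (V + Q) * t := by ring
        _ ≤ (V + Q) * t ^ (l + 1) := by gcongr
    rw [hD, Real.norm_eq_abs, abs_div, abs_mul, Real.abs_exp, abs_of_pos (pow_pos ht0 _),
      mul_div_assoc]
    refine mul_le_mul (Real.exp_le_exp.2 ?_) h1 (by positivity) (Real.exp_pos _).le
    nlinarith
  have hDx : 0 ≤ D x := by
    refine le_of_tendsto hlim ?_
    filter_upwards [Filter.eventually_ge_atTop x] with t ht
    exact hanti hx (hx.trans_le ht) ht
  have h3 : 0 < Real.exp (-x ^ 2 / 2) / x ^ (l + 1) := by positivity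
  have h4 : D x = Real.exp (-x ^ 2 / 2) / x ^ (l + 1) * (x * v x + q x) := by
    rw [hD]; ring
  exact nonneg_of_mul_nonneg_right (h4 ▸ hDx) h3

/-- If `v' = x v + q - H` and `q' = l v` with `v` bounded and `q`, `H` nonnegative, `q` bounded,
then `x v + q` is nonnegative. -/
lemma mul_add_nonneg {l : ℕ} {H q v : ℝ → ℝ} {Q V : ℝ}
    (hq : ∀ x, HasDerivAt q (l * v x) x) (hv : ∀ x, HasDerivAt v (x * v x + q x - H x) x)
    (hH0 : ∀ x, 0 ≤ H x) (hq0 : ∀ x, 0 ≤ q x) (hQ : ∀ x, |q x| ≤ Q) (hV : ∀ x, |v x| ≤ V)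
    (x : ℝ) : 0 ≤ x * v x + q x := by
  rcases lt_trichotomy x 0 with hx | rfl | hx
  -- The system is invariant under `x ↦ -x` when `v` also changes sign.
  · have := mul_add_nonneg_of_pos (l := l) (H := fun x => H (-x)) (q := fun x => q (-x))
      (v := fun x => -v (-x)) (Q := Q) (V := V)
      (fun x => by
        convert! (hq (-x)).comp x (hasDerivAt_neg x) using 1
        ring)
      (fun x => by
        convert! ((hv (-x)).comp x (hasDerivAt_neg x)).neg using 1
        ring)
      (fun x => hH0 _) (fun x => hq0 _) (fun x => hQ _) (fun x => by rw [abs_neg]; exact hV _)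
      (neg_pos.2 hx)
    simpa using this
  · simpa using hq0 0
  · exact mul_add_nonneg_of_pos hq hv hH0 hq0 hQ hV hx

/-- The system involves only `q - H` and `q'`, so adding `M` to both `q` and `H` preserves it; so
does negating `q`, `H` and `v`. The comparison principle then applies to `q + M` and to `M - q`. -/
lemma abs_mul_add_le {l : ℕ} {H q v : ℝ → ℝ} {M V : ℝ}
    (hq : ∀ x, HasDerivAt q (l * v x) x) (hv : ∀ x, HasDerivAt v (x * v x + q x - H x) x)
    (hH : ∀ x, |H x| ≤ M) (hQ : ∀ x, |q x| ≤ M) (hV : ∀ x, |v x| ≤ V)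
    (x : ℝ) : |x * v x + q x| ≤ M := by
  have hM : 0 ≤ M := (abs_nonneg _).trans (hH 0)
  have h1 := mul_add_nonneg (l := l) (H := fun x => H x + M) (q := fun x => q x + M) (v := v)
    (Q := M + M) (V := V) (fun x => (hq x).add_const M)
    (fun x => by convert! hv x using 1; ring)
    (fun x => by linarith [neg_le_of_abs_le (hH x)])
    (fun x => by linarith [neg_le_of_abs_le (hQ x)])
    (fun x => (abs_add_le _ _).trans (by rw [abs_of_nonneg hM]; linarith [hQ x])) hV x
  have h2 := mul_add_nonneg (l := l) (H := fun x => M - H x) (q := fun x => M - q x)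
    (v := fun x => -v x) (Q := M + M) (V := V)
    (fun x => by convert! (hq x).const_sub M using 1; ring)
    (fun x => by convert! (hv x).neg using 1; ring)
    (fun x => by linarith [le_of_abs_le (hH x)])
    (fun x => by linarith [le_of_abs_le (hQ x)])
    (fun x => (abs_sub _ _).trans (by rw [abs_of_nonneg hM]; linarith [hQ x]))
    (fun x => by rw [abs_neg]; exact hV x) x
  rw [abs_le]
  constructor <;> linarith

/-! ### Taylor's formula for a chain of derivatives -/

lemma abs_taylor_remainder_le_of_nonneg {F : ℕ → ℝ → ℝ} {m : ℕ} {M : ℝ}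
    (hF : ∀ j < m, ∀ x, HasDerivAt (F j) (F (j + 1) x) x) (hM : ∀ x, |F m x| ≤ M)
    (a : ℝ) {b : ℝ} (hb : 0 ≤ b) :
    |F 0 (a + b) - ∑ j ∈ Finset.range m, F j a * b ^ j / (j ! : ℝ)| ≤ M * b ^ m / (m ! : ℝ) := by
  induction m generalizing F b with
  | zero => simpa using hM _
  | succ m ih =>
    have ih' := fun (c : ℝ) (hc : 0 ≤ c) => ih (F := fun j => F (j + 1)) (b := c)
      (fun j hj => hF (j + 1) (by omega)) hM hc
    have hsum : ∀ c : ℝ, HasDerivAt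
        (fun c => ∑ j ∈ Finset.range (m + 1), F j a * c ^ j / (j ! : ℝ))
        (∑ j ∈ Finset.range m, F (j + 1) a * c ^ j / (j ! : ℝ)) c := by
      intro c
      simp only [Finset.sum_range_succ' _ m]
      simp only [pow_zero, Nat.factorial_zero, Nat.cast_one, mul_one, div_one]
      refine HasDerivAt.add_const _ (HasDerivAt.fun_sum fun j _ => ?_)
      convert! ((hasDerivAt_pow (j + 1) c).const_mul (F (j + 1) a)).div_const
        ((j + 1)! : ℝ) using 1
      rw [Nat.factorial_succ]
      push_cast
      have : (j ! : ℝ) ≠ 0 := by positivity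
      field_simp
    have hG : ∀ c : ℝ, HasDerivAt
        (fun c => F 0 (a + c) - ∑ j ∈ Finset.range (m + 1), F j a * c ^ j / (j ! : ℝ))
        (F 1 (a + c) - ∑ j ∈ Finset.range m, F (j + 1) a * c ^ j / (j ! : ℝ)) c := fun c =>
      ((hF 0 (by omega) (a + c)).comp_const_add a c).sub (hsum c)
    have hB : ∀ c : ℝ, HasDerivAt (fun c => M * c ^ (m + 1) / ((m + 1)! : ℝ))
        (M * c ^ m / (m ! : ℝ)) c := by
      intro c
      convert! ((hasDerivAt_pow (m + 1) c).const_mul M).div_const ((m + 1)! : ℝ) using 1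
      rw [Nat.factorial_succ]
      push_cast
      have : (m ! : ℝ) ≠ 0 := by positivity
      field_simp
    -- The derivative of the remainder in `c` is the remainder one order lower for the shifted
    -- chain, bounded by induction. Comparing derivatives avoids integrating `F m`, which may be
    -- discontinuous.
    refine image_norm_le_of_norm_deriv_right_le_deriv_boundary (a := 0) (b := b)
      (fun c _ => (hG c).continuousAt.continuousWithinAt)
      (fun c _ => (hG c).hasDerivWithinAt) ?_ hB (fun c hc => ih' c hc.1) ⟨hb, le_rfl⟩
    simp [Finset.sum_range_succ']

lemma abs_taylor_remainder_le {F : ℕ → ℝ → ℝ} {m : ℕ} {M : ℝ}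
    (hF : ∀ j < m, ∀ x, HasDerivAt (F j) (F (j + 1) x) x) (hM : ∀ x, |F m x| ≤ M) (a b : ℝ) :
    |F 0 (a + b) - ∑ j ∈ Finset.range m, F j a * b ^ j / (j ! : ℝ)| ≤
      M * |b| ^ m / (m ! : ℝ) := by
  rcases le_total 0 b with hb | hb
  · rw [abs_of_nonneg hb]
    exact abs_taylor_remainder_le_of_nonneg hF hM a hb
  · have := abs_taylor_remainder_le_of_nonneg (F := fun j x => (-1) ^ j * F j (-x)) (m := m)
      (M := M) (fun j hj x => by
        convert! ((hF j hj (-x)).comp x (hasDerivAt_neg x)).const_mul ((-1 : ℝ) ^ j) using 1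
        ring) (fun x => by simpa [abs_mul] using hM _) (-a) (neg_nonneg.2 hb)
    rw [abs_of_nonpos hb]
    convert! this using 3
    · simp [add_comm]
    · refine Finset.sum_congr rfl fun j _ => ?_
      rw [neg_neg, neg_pow b j]
      have : ((-1 : ℝ) ^ j) * (-1) ^ j = 1 := by rw [← mul_pow]; simp
      linear_combination (-(F j a * b ^ j / (j ! : ℝ))) * this

end MatchingMoments

namespace MatchingMoments

/-! ### The solution of the Stein equation and its derivatives -/

noncomputable section

/-- The `j`-th derivative of the solution `f` of the Stein equation `f' - x f = h - Φ h`. -/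
def steinSol (h : ℝ → ℝ) (j : ℕ) (x : ℝ) : ℝ := -ouAverage j (iteratedDeriv (j + 1) h) x

/-- The zeroth-order term in the equation satisfied by the `(j + 1)`-st derivative of the
solution of the Stein equation. -/
def steinRemainder (h : ℝ → ℝ) : ℕ → ℝ → ℝ
  | 0, _ => normalExp h
  | j + 1, x => -((j : ℝ) + 1) * steinSol h j x

end

variable {n p : ℕ} {h : ℝ → ℝ}

lemma MemCb.hasDerivAt (hh : MemCb n h) {k : ℕ} (hk : k < n) (x : ℝ) :
    HasDerivAt (iteratedDeriv k h) (iteratedDeriv (k + 1) h x) x := by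
  rw [iteratedDeriv_succ]
  exact (hh.1 k hk x).hasDerivAt

lemma MemCb.abs_le_supNorm (hh : MemCb n h) {k : ℕ} (hk : k ≤ n) (x : ℝ) :
    |iteratedDeriv k h x| ≤ supNorm (iteratedDeriv k h) := by
  obtain ⟨C, hC⟩ := hh.2 k hk
  exact le_ciSup (f := fun x => |iteratedDeriv k h x|) ⟨C, by rintro _ ⟨y, rfl⟩; exact hC y⟩ x

lemma supNorm_nonneg (f : ℝ → ℝ) : 0 ≤ supNorm f :=
  Real.iSup_nonneg fun _ => abs_nonneg _

lemma hasDerivAt_steinSol (hh : MemCb (p + 1) h) {j : ℕ} (hj : j < p) (x : ℝ) :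
    HasDerivAt (steinSol h j) (steinSol h (j + 1) x) x :=
  (hasDerivAt_ouAverage (hh.hasDerivAt (show j + 1 < p + 1 by omega))
    (hh.abs_le_supNorm (by omega)) (hh.abs_le_supNorm (show j + 1 + 1 ≤ p + 1 by omega)) j x).neg

lemma abs_steinSol_le (hh : MemCb (p + 1) h) {j : ℕ} (hj : j ≤ p) (x : ℝ) :
    |steinSol h j x| ≤ supNorm (iteratedDeriv (j + 1) h) / ((j : ℝ) + 1) := by
  rw [steinSol, abs_neg]
  exact abs_ouAverage_le (hh.abs_le_supNorm (by omega)) j x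

/-- This is the relation `q' = l v` of the comparison principle, with `v = -steinSol h j` and `l =
j`; the factor `j` covers the constant case `j = 0`. -/
lemma hasDerivAt_steinRemainder (hh : MemCb (p + 1) h) {j : ℕ} (hj : j ≤ p) (x : ℝ) :
    HasDerivAt (steinRemainder h j) (j * -steinSol h j x) x := by
  cases j with
  | zero =>
    convert! hasDerivAt_const x (normalExp h) using 1
    simp
  | succ j =>
    convert! (hasDerivAt_steinSol hh (show j < p by omega) x).const_mul (-((j : ℝ) + 1)) using 1
    push_cast
    ring

lemma abs_steinRemainder_le (hh : MemCb (p + 1) h) {j : ℕ} (hj : j ≤ p) (x : ℝ) :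
    |steinRemainder h j x| ≤ supNorm (iteratedDeriv j h) := by
  cases j with
  | zero =>
    have : ‖∫ x, h x ∂(gaussianReal 0 1)‖ ≤ supNorm (iteratedDeriv 0 h) *
        (gaussianReal 0 1).real Set.univ :=
      norm_integral_le_of_norm_le_const (Filter.Eventually.of_forall fun x => by
        simpa using hh.abs_le_supNorm (k := 0) (by omega) x)
    simpa [steinRemainder, normalExp] using this
  | succ j =>
    have h1 := abs_steinSol_le hh (show j ≤ p by omega) x
    have h2 : (0 : ℝ) < (j : ℝ) + 1 := by positivity
    rw [le_div_iff₀ h2] at h1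
    rw [steinRemainder, abs_mul, abs_neg, abs_of_pos h2, mul_comm]
    exact h1

/-- The Stein equation, differentiated `j` times. -/
lemma steinSol_succ (hh : MemCb (p + 1) h) {j : ℕ} (hj : j < p) (x : ℝ) :
    steinSol h (j + 1) x =
      x * steinSol h j x - steinRemainder h j x + iteratedDeriv j h x := by
  induction j generalizing x with
  | zero =>
    have := ouAverage_stein (hh.hasDerivAt (k := 0) (by omega))
      (hh.hasDerivAt (k := 1) (by omega)) (hh.abs_le_supNorm (by omega))
      (hh.abs_le_supNorm (by omega)) (hh.abs_le_supNorm (by omega)) x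
    simp only [steinSol, steinRemainder, iteratedDeriv_zero, zero_add] at this ⊢
    linarith
  | succ j ih =>
    have h1 := hasDerivAt_steinSol hh hj x
    have h2 := (((hasDerivAt_id x).mul (hasDerivAt_steinSol hh (show j < p by omega) x)).sub
      (hasDerivAt_steinRemainder hh (show j ≤ p by omega) x)).add
      (hh.hasDerivAt (show j < p + 1 by omega) x)
    have h3 : steinSol h (j + 1) = (id * steinSol h j - steinRemainder h j) + iteratedDeriv j h :=
      funext fun y => ih (by omega) y
    have := (h3 ▸ h1).unique h2
    rw [this]
    simp only [id_eq, steinRemainder]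
    ring

lemma abs_steinSol_le_three_mul (hh : MemCb (p + 1) h) (hp : 1 ≤ p) (x : ℝ) :
    |steinSol h p x| ≤ 3 * supNorm (iteratedDeriv (p - 1) h) := by
  obtain ⟨m, rfl⟩ : ∃ m, p = m + 1 := ⟨p - 1, by omega⟩
  rw [Nat.add_sub_cancel]
  have hH := hh.abs_le_supNorm (show m ≤ m + 1 + 1 by omega)
  have key := abs_mul_add_le (l := m) (H := iteratedDeriv m h) (q := steinRemainder h m)
    (v := fun x => -steinSol h m x) (hasDerivAt_steinRemainder hh (by omega))
    (fun x => by
      convert! (hasDerivAt_steinSol hh (show m < m + 1 by omega) x).neg using 1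
      rw [steinSol_succ hh (by omega)]
      ring) hH (abs_steinRemainder_le hh (by omega))
    (fun x => by rw [abs_neg]; exact abs_steinSol_le hh (by omega) x) x
  -- The derivative sought is `H - (x v + q)`, and both terms are at most the same norm, so the
  -- argument yields the factor 2, hence 3.
  have := hH x
  have hn := supNorm_nonneg (iteratedDeriv m h)
  rw [steinSol_succ hh (by omega)]
  rw [abs_le] at *
  constructor <;> linarith

lemma abs_steinSol_le_N (hh : MemCb (p + 1) h) (hp : 1 ≤ p) (x : ℝ) :
    |steinSol h p x| ≤ N h p := by
  refine le_min (abs_steinSol_le_three_mul hh hp x) (le_min ?_ (abs_steinSol_le hh le_rfl x))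
  rw [steinSol, abs_neg]
  exact abs_ouAverage_deriv_le (hh.hasDerivAt (show p < p + 1 by omega))
    (hh.abs_le_supNorm (by omega)) (hh.abs_le_supNorm le_rfl) p x

/-! ### Stein's method -/

section Independence

variable {Ω : Type*} [MeasurableSpace Ω] {P : Measure Ω} [IsProbabilityMeasure P]

lemma integrable_abs_pow_of_le {Y : Ω → ℝ} (hY : Measurable Y) {k m : ℕ} (hk : k ≤ m)
    (hi : Integrable (fun ω => |Y ω| ^ m) P) : Integrable (fun ω => |Y ω| ^ k) P := by
  refine ((integrable_const (1 : ℝ)).add hi).mono' (by fun_prop)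
    (Filter.Eventually.of_forall fun ω => ?_)
  have h0 := abs_nonneg (Y ω)
  rw [Real.norm_eq_abs, abs_of_nonneg (by positivity)]
  rcases le_total |Y ω| 1 with h1 | h1
  · exact (pow_le_one₀ h0 h1).trans (le_add_of_nonneg_right (by positivity))
  · exact (pow_le_pow_right₀ h1 hk).trans (le_add_of_nonneg_left zero_le_one)

lemma integrable_pow_of_le {Y : Ω → ℝ} (hY : Measurable Y) {k m : ℕ} (hk : k ≤ m)
    (hi : Integrable (fun ω => |Y ω| ^ m) P) : Integrable (fun ω => Y ω ^ k) P :=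
  (integrable_abs_pow_of_le hY hk hi).mono' (by fun_prop)
    (Filter.Eventually.of_forall fun ω => by simp)

/-- One summand in Stein's method: if `V` and `Y` are independent and the moments of `Y` up to
order `p` satisfy the recursion of a centred normal law with variance `s`, then
`s E f'(V + Y) - E Y f(V + Y)` is controlled by the `p`-th derivative of `f`. -/
lemma abs_stein_summand_le {F : ℕ → ℝ → ℝ} {M s : ℝ} {V Y : Ω → ℝ} (hp : 1 ≤ p)
    (hF : ∀ j < p, ∀ x, HasDerivAt (F j) (F (j + 1) x) x)
    (hb : ∀ j ≤ p, ∃ C, ∀ x, |F j x| ≤ C) (hM : ∀ x, |F p x| ≤ M) (hs : 0 ≤ s)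
    (hV : Measurable V) (hY : Measurable Y) (hVY : IndepFun V Y P)
    (hi : Integrable (fun ω => |Y ω| ^ (p + 1)) P) (hmean : ∫ ω, Y ω ∂P = 0)
    (hmom : ∀ l, l + 2 ≤ p → ∫ ω, Y ω ^ (l + 2) ∂P = s * (l + 1) * ∫ ω, Y ω ^ l ∂P) :
    |∫ ω, (s * F 1 (V ω + Y ω) - Y ω * F 0 (V ω + Y ω)) ∂P| ≤
      M * (s * ((∫ ω, |Y ω| ^ (p - 1) ∂P) / ((p - 1)! : ℝ)) +
        (∫ ω, |Y ω| ^ (p + 1) ∂P) / (p ! : ℝ)) := by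
  obtain ⟨m, rfl⟩ : ∃ m, p = m + 1 := ⟨p - 1, by omega⟩
  rw [Nat.add_sub_cancel]
  have hFm : ∀ j ≤ m + 1, Measurable (F j) := by
    intro j hj
    rcases Nat.lt_or_ge j (m + 1) with h1 | h1
    · exact (continuous_of_hasDerivAt (hF j h1)).measurable
    · obtain rfl : j = m + 1 := by omega
      exact measurable_of_hasDerivAt (hF m (by omega))
  have hprod : ∀ j ≤ m + 1, ∀ G : Ω → ℝ, ∀ U : Ω → ℝ, Measurable U → Integrable G P →
      Integrable (fun ω => F j (U ω) * G ω) P := by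
    intro j hj G U hU hG
    obtain ⟨C, hC⟩ := hb j hj
    exact hG.bdd_mul ((hFm j hj).comp hU).aestronglyMeasurable
      (Filter.Eventually.of_forall fun ω => hC _)
  have hindep : ∀ j ≤ m + 1, ∀ g : ℝ → ℝ, Measurable g →
      ∫ ω, F j (V ω) * g (Y ω) ∂P = (∫ ω, F j (V ω) ∂P) * ∫ ω, g (Y ω) ∂P := by
    intro j hj g hg
    exact (hVY.comp (hFm j hj) hg).integral_fun_mul_eq_mul_integral
      ((hFm j hj).comp hV).aestronglyMeasurable (hg.comp hY).aestronglyMeasurable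
  have hpow : ∀ k ≤ m + 2, Integrable (fun ω => Y ω ^ k) P := fun k hk =>
    integrable_pow_of_le hY hk hi
  -- The Taylor polynomial about `V` of the integrand, grouped by the derivative `F (j + 1)`.
  -- Expanding `F 1` to order `m` and `F 0` to order `m + 1` makes both remainders depend on `F (m +
  -- 1)`.
  set B : Ω → ℝ := fun ω => (∑ j ∈ Finset.range m,
      F (j + 1) (V ω) * (s * (Y ω ^ j / (j ! : ℝ)) - Y ω ^ (j + 2) / ((j + 1)! : ℝ))) -
      F 0 (V ω) * Y ω with hB
  have hg : ∀ j ∈ Finset.range m, Integrable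
      (fun ω => s * (Y ω ^ j / (j ! : ℝ)) - Y ω ^ (j + 2) / ((j + 1)! : ℝ)) P := by
    intro j hj
    have := Finset.mem_range.1 hj
    exact (((hpow j (by omega)).div_const _).const_mul s).sub ((hpow (j + 2) (by omega)).div_const _)
  have hY1 : Integrable Y P := by simpa using hpow 1 (by omega)
  have hsum : ∀ j ∈ Finset.range m, Integrable (fun ω => F (j + 1) (V ω) *
      (s * (Y ω ^ j / (j ! : ℝ)) - Y ω ^ (j + 2) / ((j + 1)! : ℝ))) P := fun j hj =>
    hprod (j + 1) (by have := Finset.mem_range.1 hj; omega) _ V hV (hg j hj)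
  have hBi : Integrable B P :=
    (integrable_finsetSum _ hsum).sub (hprod 0 (by omega) Y V hV hY1)
  have hB0 : ∫ ω, B ω ∂P = 0 := by
    rw [hB, integral_sub (integrable_finsetSum _ hsum) (hprod 0 (by omega) Y V hV hY1),
      integral_finsetSum _ hsum, hindep 0 (by omega) (fun y => y) measurable_id, hmean, mul_zero,
      sub_zero]
    -- By independence each term factors, and the recursion for `E Y^(j+2)` makes the `Y` factor
    -- vanish since `(j+1)! = (j+1) j!`.
    refine Finset.sum_eq_zero fun j hj => ?_
    have hj' := Finset.mem_range.1 hj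
    rw [hindep (j + 1) (by omega)
      (fun y => s * (y ^ j / (j ! : ℝ)) - y ^ (j + 2) / ((j + 1)! : ℝ)) (by fun_prop)]
    rw [integral_sub (((hpow j (by omega)).div_const _).const_mul s)
      ((hpow (j + 2) (by omega)).div_const _), integral_const_mul, integral_div, integral_div,
      hmom j (by omega), Nat.factorial_succ]
    push_cast
    have : (j ! : ℝ) ≠ 0 := by positivity
    field_simp
    ring
  have hVYm : Measurable fun ω => V ω + Y ω := hV.add hY
  have hAi : Integrable (fun ω => s * F 1 (V ω + Y ω) - Y ω * F 0 (V ω + Y ω)) P := by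
    have h1 := hprod 1 (by omega) (fun _ => s) _ hVYm (integrable_const s)
    have h2 := hprod 0 (by omega) Y _ hVYm hY1
    refine (h1.sub h2).congr (Filter.Eventually.of_forall fun ω => ?_)
    simp [mul_comm]
  have habs1 := integrable_abs_pow_of_le hY (show m ≤ m + 2 by omega) hi
  calc |∫ ω, (s * F 1 (V ω + Y ω) - Y ω * F 0 (V ω + Y ω)) ∂P|
      = ‖∫ ω, (s * F 1 (V ω + Y ω) - Y ω * F 0 (V ω + Y ω) - B ω) ∂P‖ := by
        rw [integral_sub hAi hBi, hB0, sub_zero, Real.norm_eq_abs]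
    _ ≤ ∫ ω, (M * (s * (|Y ω| ^ m / (m ! : ℝ))) + M * (|Y ω| ^ (m + 2) / ((m + 1)! : ℝ))) ∂P := by
        refine norm_integral_le_of_norm_le
          ((((habs1.div_const _).const_mul s).const_mul M).add ((hi.div_const _).const_mul M))
          (Filter.Eventually.of_forall fun ω => ?_)
        have t0 := abs_taylor_remainder_le hF hM (V ω) (Y ω)
        have t1 := abs_taylor_remainder_le (F := fun j => F (j + 1)) (m := m) (M := M)
          (fun j hj => hF (j + 1) (by omega)) hM (V ω) (Y ω)
        have e : s * F 1 (V ω + Y ω) - Y ω * F 0 (V ω + Y ω) - B ω =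
            s * (F (0 + 1) (V ω + Y ω) -
              ∑ j ∈ Finset.range m, F (j + 1) (V ω) * Y ω ^ j / (j ! : ℝ)) -
            Y ω * (F 0 (V ω + Y ω) -
              ∑ j ∈ Finset.range (m + 1), F j (V ω) * Y ω ^ j / (j ! : ℝ)) := by
          rw [hB, Finset.sum_range_succ']
          simp only [mul_sub, Finset.sum_sub_distrib, mul_add, Finset.mul_sum]
          have e1 : ∑ j ∈ Finset.range m, F (j + 1) (V ω) * (s * (Y ω ^ j / (j ! : ℝ))) =
              ∑ j ∈ Finset.range m, s * (F (j + 1) (V ω) * Y ω ^ j / (j ! : ℝ)) :=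
            Finset.sum_congr rfl fun j _ => by ring
          have e2 : ∑ j ∈ Finset.range m, F (j + 1) (V ω) * (Y ω ^ (j + 2) / ((j + 1)! : ℝ)) =
              ∑ j ∈ Finset.range m, Y ω * (F (j + 1) (V ω) * Y ω ^ (j + 1) / ((j + 1)! : ℝ)) :=
            Finset.sum_congr rfl fun j _ => by ring
          rw [e1, e2]
          simp
          ring
        rw [Real.norm_eq_abs, e]
        refine (abs_sub _ _).trans (add_le_add ?_ ?_)
        · rw [abs_mul, abs_of_nonneg hs]
          refine (mul_le_mul_of_nonneg_left t1 hs).trans_eq (by ring)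
        · rw [abs_mul]
          refine (mul_le_mul_of_nonneg_left t0 (abs_nonneg _)).trans_eq (by ring)
    _ = _ := by
        rw [integral_add (((habs1.div_const _).const_mul s).const_mul M)
          ((hi.div_const _).const_mul M)]
        simp only [integral_const_mul, integral_div]
        ring

end Independence

end MatchingMoments

namespace MatchingMoments

/-! ### Summation over the independent summands -/

section ErrorBound

variable {n p : ℕ} {h : ℝ → ℝ} {Ω : Type*} [MeasurableSpace Ω] {P : Measure Ω}
  [IsProbabilityMeasure P]

lemma integral_pow_add_two_of_moments {Y : Ω → ℝ}
    (hmom : ∀ k : ℕ, 1 ≤ k → k ≤ p → ∫ ω, Y ω ^ k ∂P = ∫ x, x ^ k ∂(gaussianReal 0 1))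
    {l : ℕ} (hl : l + 2 ≤ p) :
    ∫ ω, Y ω ^ (l + 2) ∂P = (l + 1) * ∫ ω, Y ω ^ l ∂P := by
  have h0 : ∫ ω, Y ω ^ l ∂P = ∫ x, x ^ l ∂(gaussianReal 0 1) := by
    -- The zeroth moment is outside the matching hypothesis, but both measures have mass one.
    rcases Nat.eq_zero_or_pos l with rfl | h1
    · simp
    · exact hmom l h1 (by omega)
  rw [hmom (l + 2) (by omega) hl, h0, integral_pow_add_two_gaussianReal]

lemma sqrt_pow_eq_rpow (n p : ℕ) :
    Real.sqrt n ^ (p + 1) = (n : ℝ) ^ (((p : ℝ) + 1) / 2) := by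
  rw [Real.sqrt_eq_rpow, ← Real.rpow_natCast, ← Real.rpow_mul (Nat.cast_nonneg n)]
  congr 1
  push_cast
  ring

/-- The error of the normal approximation for independent summands with matching moments. -/
lemma error_le_bound (hp : 1 ≤ p) (hh : MemCb (p + 1) h) (hn : 1 ≤ n) {X : Fin n → Ω → ℝ}
    (hX : ∀ i, Measurable (X i)) (hind : iIndepFun X P)
    (hi : ∀ i, Integrable (fun ω => |X i ω| ^ (p + 1)) P)
    (hmom : ∀ i, ∀ k : ℕ, 1 ≤ k → k ≤ p →
      ∫ ω, X i ω ^ k ∂P = ∫ x, x ^ k ∂(gaussianReal 0 1)) :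
    error P h X ≤ bound P h p X := by
  have hn0 : (0 : ℝ) < n := by exact_mod_cast hn
  set r := Real.sqrt n with hr
  have hr0 : 0 < r := Real.sqrt_pos.2 hn0
  have hrr : r ^ 2 = n := Real.sq_sqrt hn0.le
  set Y : Fin n → Ω → ℝ := fun i ω => X i ω / r with hYdef
  set V : Fin n → Ω → ℝ := fun i ω => (∑ j ∈ Finset.univ.erase i, X j ω) / r with hVdef
  have hY : ∀ i, Measurable (Y i) := fun i => (hX i).div_const r
  have hV : ∀ i, Measurable (V i) := fun i =>
    (Finset.measurable_fun_sum _ fun j _ => hX j).div_const r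
  have hW : ∀ i ω, V i ω + Y i ω = W X ω := by
    intro i ω
    simp only [hVdef, hYdef, W, ← hr]
    rw [← add_div, Finset.sum_erase_add _ _ (Finset.mem_univ i)]
  have hWsum : ∀ ω, ∑ i, Y i ω = W X ω := fun ω => by
    simp only [hYdef, W, ← hr, Finset.sum_div]
  have hWm : Measurable (W X) := (Finset.measurable_fun_sum _ fun j _ => hX j).div_const r
  have hVY : ∀ i, IndepFun (V i) (Y i) P := by
    intro i
    have h1 := hind.indepFun_finsetSum_of_notMem hX (Finset.notMem_erase i Finset.univ)
    have hdiv : Measurable fun x : ℝ => x / r := measurable_id.div_const r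
    have h2 := h1.comp hdiv hdiv
    convert! h2 using 1
    ext ω
    simp [hVdef]
  have habs : ∀ i k, (fun ω => |Y i ω| ^ k) = fun ω => |X i ω| ^ k / r ^ k := by
    intro i k
    ext ω
    simp only [hYdef]
    rw [abs_div, abs_of_pos hr0, div_pow]
  have hYi : ∀ i, Integrable (fun ω => |Y i ω| ^ (p + 1)) P := by
    intro i
    rw [habs]
    exact (hi i).div_const _
  have hYpow : ∀ i k, ∫ ω, Y i ω ^ k ∂P = (∫ ω, X i ω ^ k ∂P) / r ^ k := by
    intro i k
    simp only [hYdef, div_pow, integral_div]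
  have hs0 : (0 : ℝ) ≤ 1 / n := by positivity
  have hsummand := fun i => abs_stein_summand_le (P := P) (F := steinSol h) (M := N h p)
    (s := 1 / n) hp (fun j hj => hasDerivAt_steinSol hh hj)
    (fun j hj => ⟨_, abs_steinSol_le hh hj⟩) (abs_steinSol_le_N hh hp) hs0 (hV i) (hY i) (hVY i)
    (hYi i)
    (by
      have := hYpow i 1
      rw [hmom i 1 le_rfl hp] at this
      simpa using this)
    (fun l hl => by
      rw [hYpow, hYpow, integral_pow_add_two_of_moments (hmom i) hl, pow_add, hrr]
      field_simp)
  -- The Stein equation at `W`, with `f'(W)` split into `n` equal parts and the factor `W` into the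
  -- `Y i`.
  have hWF : ∀ ω, h (W X ω) - normalExp h =
      ∑ i, (1 / (n : ℝ) * steinSol h 1 (V i ω + Y i ω) - Y i ω * steinSol h 0 (V i ω + Y i ω)) := by
    intro ω
    simp only [hW]
    rw [Finset.sum_sub_distrib, ← Finset.sum_mul, ← Finset.sum_mul, hWsum]
    have := steinSol_succ hh (show 0 < p by omega) (W X ω)
    simp only [zero_add, steinRemainder, iteratedDeriv_zero] at this
    rw [this]
    have : ∑ _i : Fin n, 1 / (n : ℝ) = 1 := by simp [hn0.ne']
    rw [this]
    ring
  have hFc : ∀ j < p, Measurable (steinSol h j) := fun j hj =>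
    (continuous_of_hasDerivAt (hasDerivAt_steinSol hh hj)).measurable
  have hF1 : Measurable (steinSol h 1) :=
    measurable_of_hasDerivAt (hasDerivAt_steinSol hh (show 0 < p by omega))
  have hsi : ∀ i ∈ Finset.univ, Integrable (fun ω =>
      1 / (n : ℝ) * steinSol h 1 (V i ω + Y i ω) - Y i ω * steinSol h 0 (V i ω + Y i ω)) P := by
    intro i _
    simp only [hW]
    have hYi1 : Integrable (Y i) P := by
      simpa using integrable_pow_of_le (hY i) (show 1 ≤ p + 1 by omega) (hYi i)
    refine Integrable.sub (Integrable.const_mul ?_ _) (hYi1.mul_bdd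
      ((hFc 0 (by omega)).comp hWm).aestronglyMeasurable
      (Filter.Eventually.of_forall fun ω => abs_steinSol_le hh (Nat.zero_le p) _))
    exact (integrable_const _).mono' (hF1.comp hWm).aestronglyMeasurable
      (Filter.Eventually.of_forall fun ω => abs_steinSol_le hh hp _)
  have hhc : Continuous h := by
    simpa using continuous_of_hasDerivAt (hh.hasDerivAt (show 0 < p + 1 by omega))
  have hhi : Integrable (fun ω => h (W X ω)) P :=
    (integrable_const _).mono' (hhc.measurable.comp hWm).aestronglyMeasurable
      (Filter.Eventually.of_forall fun ω => by
        simpa using hh.abs_le_supNorm (Nat.zero_le _) (W X ω))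
  calc error P h X
      = |∑ i, ∫ ω, (1 / (n : ℝ) * steinSol h 1 (V i ω + Y i ω) -
          Y i ω * steinSol h 0 (V i ω + Y i ω)) ∂P| := by
        rw [error, ← integral_finsetSum _ hsi]
        simp only [← hWF]
        rw [integral_sub hhi (integrable_const _)]
        simp
    _ ≤ ∑ i, N h p * (1 / n * ((∫ ω, |Y i ω| ^ (p - 1) ∂P) / ((p - 1)! : ℝ)) +
          (∫ ω, |Y i ω| ^ (p + 1) ∂P) / (p ! : ℝ)) :=
        (Finset.abs_sum_le_sum_abs _ _).trans (Finset.sum_le_sum fun i _ => hsummand i)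
    _ = bound P h p X := by
        rw [bound, Finset.mul_sum, ← sqrt_pow_eq_rpow, ← hr]
        refine Finset.sum_congr rfl fun i _ => ?_
        rw [habs, habs, integral_div, integral_div, ← hrr,
          show r ^ (p + 1) = r ^ (p - 1) * r ^ 2 by rw [← pow_add]; congr 1; omega]
        field_simp

end ErrorBound

/-! ### Identically distributed summands -/

/-- A bounded function with a vanishing derivative of some order is constant. -/
lemma MemCb.eq_const_of_iteratedDeriv_eq_zero {m : ℕ} {h : ℝ → ℝ} (hh : MemCb m h) {k : ℕ}
    (hk : k ≤ m) (h0 : ∀ x, iteratedDeriv k h x = 0) : ∃ a, ∀ x, h x = a := by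
  induction k with
  | zero => exact ⟨0, by simpa using h0⟩
  | succ k ih =>
    have hd : ∀ x y, iteratedDeriv k h x = iteratedDeriv k h y :=
      is_const_of_deriv_eq_zero (hh.1 k (by omega)) fun x => by
        rw [← iteratedDeriv_succ]; exact h0 x
    cases k with
    | zero => exact ⟨h 0, fun x => by simpa using hd x 0⟩
    | succ k =>
      refine ih (by omega) fun x => ?_
      rw [hd x 0]
      set c := iteratedDeriv (k + 1) h 0 with hc
      obtain ⟨C, hC⟩ := hh.2 k (by omega)
      have hlin : ∀ x, iteratedDeriv k h x = iteratedDeriv k h 0 + c * x := by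
        intro x
        have hd' : ∀ y, HasDerivAt (fun y => iteratedDeriv k h y - c * y) 0 y := fun y => by
          have h1 := hh.hasDerivAt (show k < m by omega) y
          rw [hd y 0] at h1
          convert! h1.sub ((hasDerivAt_id y).const_mul c) using 1
          simp [hc]
        have := is_const_of_deriv_eq_zero (fun y => (hd' y).differentiableAt)
          (fun y => (hd' y).deriv) x 0
        simp only [mul_zero, sub_zero] at this
        linarith
      by_contra hne
      -- An affine function with slope `c ≠ 0` increases by `2 * C + 1` between `0` and this point,
      -- impossible for values in `[-C, C]`.
      have h1 := hC ((2 * C + 1) / c)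
      rw [hlin, mul_div_cancel₀ _ hne] at h1
      have h2 := hC 0
      rw [abs_le] at h1 h2
      linarith [h1.2, h2.1]

lemma MemCb.supNorm_iteratedDeriv_pos {m : ℕ} {h : ℝ → ℝ} (hh : MemCb m h) {k : ℕ}
    (hk : k ≤ m) (hc : ¬ ∃ a, ∀ x, h x = a) : 0 < supNorm (iteratedDeriv k h) := by
  refine (supNorm_nonneg _).lt_of_ne' fun h0 => hc ?_
  refine hh.eq_const_of_iteratedDeriv_eq_zero hk fun x => ?_
  have := hh.abs_le_supNorm hk x
  rw [h0] at this
  exact abs_nonpos_iff.1 this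

lemma N_pos {p : ℕ} {h : ℝ → ℝ} (hh : MemCb (p + 1) h) (hc : ¬ ∃ a, ∀ x, h x = a) :
    0 < N h p := by
  have h1 := hh.supNorm_iteratedDeriv_pos (show p - 1 ≤ p + 1 by omega) hc
  have h2 := hh.supNorm_iteratedDeriv_pos (show p ≤ p + 1 by omega) hc
  have h3 := hh.supNorm_iteratedDeriv_pos (le_refl (p + 1)) hc
  have h4 := Real.Gamma_pos_of_pos (show 0 < ((p : ℝ) + 1) / 2 by positivity)
  have h5 := Real.Gamma_pos_of_pos (show 0 < (p : ℝ) / 2 + 1 by positivity)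
  exact lt_min (by positivity) (lt_min (by positivity) (by positivity))

/-- The common value of the summands of `bound` for identically distributed variables. -/
noncomputable def absMoments (p : ℕ) (μ : Measure ℝ) : ℝ :=
  (∫ x, |x| ^ (p - 1) ∂μ) / ((p - 1)! : ℝ) + (∫ x, |x| ^ (p + 1) ∂μ) / (p ! : ℝ)

lemma absMoments_pos {p : ℕ} (hp : 1 ≤ p) {μ : Measure ℝ} [IsProbabilityMeasure μ]
    (hμ : MatchesNormal p μ) : 0 < absMoments p μ := by
  have hA : 0 ≤ (∫ x, |x| ^ (p - 1) ∂μ) / ((p - 1)! : ℝ) := by positivity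
  have hB : 0 ≤ (∫ x, |x| ^ (p + 1) ∂μ) / (p ! : ℝ) := by positivity
  -- For `p = 1` the first moment term is the total mass, equal to one. For `p ≥ 2` a vanishing top
  -- moment would concentrate `μ` at zero, contradicting its unit second moment.
  rcases Nat.eq_or_lt_of_le hp with rfl | hp2
  · have : (0 : ℝ) < (∫ x, |x| ^ (1 - 1) ∂μ) / ((1 - 1)! : ℝ) := by simp
    exact add_pos_of_pos_of_nonneg this hB
  · refine add_pos_of_nonneg_of_pos hA (div_pos ?_ (by positivity))
    refine (integral_nonneg fun x => by positivity).lt_of_ne' fun h0 => ?_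
    rw [integral_eq_zero_iff_of_nonneg (fun x => by positivity) hμ.1] at h0
    have h2 := hμ.2 2 (by omega) hp2
    rw [integral_pow_add_two_gaussianReal 0] at h2
    have h3 : ∫ x, x ^ 2 ∂μ = 0 := by
      refine integral_eq_zero_of_ae ?_
      filter_upwards [h0] with x hx
      have : x = 0 := by simpa using hx
      simp [this]
    rw [h3] at h2
    norm_num at h2

lemma bound_eq_of_map_eq {n p : ℕ} {h : ℝ → ℝ} {Ω : Type*} [MeasurableSpace Ω] {P : Measure Ω}
    {μ : Measure ℝ} (hn : 1 ≤ n) {X : Fin n → Ω → ℝ} (hX : ∀ i, Measurable (X i))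
    (hmap : ∀ i, P.map (X i) = μ) :
    bound P h p X = N h p * absMoments p μ * (n : ℝ) ^ (-(((p : ℝ) - 1) / 2)) := by
  have hn0 : (0 : ℝ) < n := by exact_mod_cast hn
  have hint : ∀ i k, ∫ ω, |X i ω| ^ k ∂P = ∫ x, |x| ^ k ∂μ := by
    intro i k
    rw [← hmap i, integral_map (hX i).aemeasurable (by fun_prop)]
  have hpow : (n : ℝ) ^ (-(((p : ℝ) - 1) / 2)) = n / (n : ℝ) ^ (((p : ℝ) + 1) / 2) := by
    rw [eq_div_iff (by positivity), ← Real.rpow_add hn0]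
    conv_rhs => rw [← Real.rpow_one (n : ℝ)]
    congr 1
    ring
  simp only [bound, hint, Finset.sum_const, Finset.card_univ, Fintype.card_fin, nsmul_eq_mul]
  rw [hpow, absMoments]
  ring

end MatchingMoments

/-- First part: the bound for independent random variables with matching moments.
Second part: for independent variables with a common law `μ`, the bound (hence the error) is of
order `n^{-(p-1)/2}`, with constants that depend only on `p`, `h` and `μ`; the order is exact as
soon as `h` is not constant (for constant `h` the bound is zero). -/
theorem mainTheorem4 (p : ℕ) (hp : 1 ≤ p) (h : ℝ → ℝ)
    (hh : MatchingMoments.MemCb (p + 1) h) :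
    (∀ (Ω : Type u) [MeasurableSpace Ω] (P : Measure Ω) [IsProbabilityMeasure P]
        (n : ℕ) (_ : 1 ≤ n) (X : Fin n → Ω → ℝ),
        (∀ i, Measurable (X i)) → iIndepFun X P →
        (∀ i, Integrable (fun ω => |X i ω| ^ (p + 1)) P) →
        (∀ i, ∀ k : ℕ, 1 ≤ k → k ≤ p →
          ∫ ω, X i ω ^ k ∂P = ∫ x, x ^ k ∂(gaussianReal 0 1)) →
        MatchingMoments.error P h X ≤ MatchingMoments.bound P h p X) ∧
    (∀ (μ : Measure ℝ) [IsProbabilityMeasure μ], MatchingMoments.MatchesNormal p μ →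
      ∃ c C : ℝ, ((¬ ∃ a : ℝ, ∀ x, h x = a) → 0 < c) ∧
        ∀ (Ω : Type u) [MeasurableSpace Ω] (P : Measure Ω) [IsProbabilityMeasure P]
          (n : ℕ) (_ : 1 ≤ n) (X : Fin n → Ω → ℝ),
          (∀ i, Measurable (X i)) → iIndepFun X P → (∀ i, P.map (X i) = μ) →
          MatchingMoments.error P h X ≤ C * (n : ℝ) ^ (-(((p : ℝ) - 1) / 2)) ∧
          c * (n : ℝ) ^ (-(((p : ℝ) - 1) / 2)) ≤ MatchingMoments.bound P h p X ∧
          MatchingMoments.bound P h p X ≤ C * (n : ℝ) ^ (-(((p : ℝ) - 1) / 2))) := by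

  refine ⟨fun Ω _ P _ n hn X hX hind hi hmom =>
    MatchingMoments.error_le_bound hp hh hn hX hind hi hmom, fun μ _ hμ =>
    -- The same constant serves as `c` and `C`, since the bound equals it times the power of `n`.
    ⟨MatchingMoments.N h p * MatchingMoments.absMoments p μ,
      MatchingMoments.N h p * MatchingMoments.absMoments p μ,
      fun hc => mul_pos (MatchingMoments.N_pos hh hc) (MatchingMoments.absMoments_pos hp hμ),
      fun Ω _ P _ n hn X hX hind hmap => ?_⟩⟩
  have hbound := MatchingMoments.bound_eq_of_map_eq (p := p) (h := h) hn hX hmap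
  refine ⟨hbound ▸ MatchingMoments.error_le_bound hp hh hn hX hind (fun i => ?_)
    fun i k hk hkp => ?_, hbound.ge, hbound.le⟩
  · have := hμ.1
    rw [← hmap i] at this
    exact this.comp_measurable (hX i)
  · rw [← hμ.2 k hk hkp, ← hmap i, integral_map (hX i).aemeasurable (by fun_prop)]
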